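/- The alternating group $A_5$ occurs infinitely often as a Galois group over $\mathbb{Q}$ with all nontrivial inertia groups of order $2$. That is, inside a fixed algebraic closure $\overline{\mathbb{Q}}$ there are infinitely many finite Galois extensions $K/\mathbb{Q}$ with $\mathrm{Gal}(K/\mathbb{Q})\cong A_5$ such that, for every nonzero prime ideal $P$ of the ring of integers $\mathcal{O}_K$, the inertia group $I(P)=\{\sigma\in\mathrm{Gal}(K/\mathbb{Q}) : \sigma(x)-x\in P \text{ for all } x\in\mathcal{O}_K\}$ is either trivial or of order $2$. -/

import Mathlib

open scoped NumberField

open Polynomial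

/-! Take the splitting field of `quintic r` for an integer r ≡ 4 mod 165 = 3·5·11. Its discriminant
is the square of an integer (`det_vandermonde_sq_of_quintic`), so the Galois group acts on the roots
by even permutations. The quintic is irreducible mod 3 and has an irreducible cubic factor mod 5, so
15 divides the group order, which forces A₅.

Reduction modulo any prime produces no triple root (`no_triple_root`). Inertia permutes roots with
equal reduction, so it consists of even permutations preserving fibres of size at most 2. Only one
nontrivial such permutation can exist (`eq_of_fiber_le_two`), hence inertia has order at most 2.

Infinitely many fields are separated by degree-one primes. If ℓ ≡ 1 mod 3 divides r, then ℓ has a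
degree-one prime, since the quintic reduces to w²(w³ - 1). A degree-one prime over q forces at least
three roots in F_q, but some residue of r mod q allows at most two. The Chinese remainder theorem
yields fields with such a prime over a new ℓ and none over the earlier ones. -/

/-! ### Triple roots over an arbitrary field. -/

/-- The hypotheses are the vanishing of the quintic and its first two Hasse derivatives; the factor
2 is already divided out, so characteristic 2 is covered. Eliminating r leaves two cubics in u = w³
that are coprime outside characteristics 3, 7, 11. -/
theorem no_triple_root_aux {k : Type*} [Field k] (r w : k)
    (h0 : w ^ 5 - r * w ^ 4 + 7 * r ^ 2 * w ^ 3 - w ^ 2 - r * w - 7 * r ^ 2 = 0)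
    (h1 : 5 * w ^ 4 - 4 * r * w ^ 3 + 21 * r ^ 2 * w ^ 2 - 2 * w - r = 0)
    (h2 : 10 * w ^ 3 - 6 * r * w ^ 2 + 21 * r ^ 2 * w - 1 = 0) :
    ((3 : k) = 0 ∧ r = 0) ∨ ((11 : k) = 0 ∧ r ^ 3 = 7) := by
  have hw : w ≠ 0 := by
    rintro rfl
    simp at h2
  have e1 : r * (2 * w ^ 3 - 1) = w * (5 * w ^ 3 + 1) := by linear_combination h1 - w * h2
  obtain ⟨u, hu⟩ : ∃ u, u = w ^ 3 := ⟨_, rfl⟩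
  have p1 : 505 * u ^ 3 + 184 * u ^ 2 + 41 * u - 1 = 0 := by
    rw [hu]
    linear_combination (2 * w ^ 3 - 1) ^ 2 * h2 + (6 * w ^ 2 * (2 * w ^ 3 - 1)
      - 21 * w * (r * (2 * w ^ 3 - 1) + w * (5 * w ^ 3 + 1))) * e1
  have p2 : 169 * u ^ 3 - 120 * u ^ 2 - 54 * u - 7 = 0 := by
    rw [hu]
    refine mul_left_cancel₀ (pow_ne_zero 2 hw) ?_
    linear_combination (2 * w ^ 3 - 1) ^ 2 * h0 + ((w ^ 4 + w) * (2 * w ^ 3 - 1)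
      - 7 * (w ^ 3 - 1) * (r * (2 * w ^ 3 - 1) + w * (5 * w ^ 3 + 1))) * e1
  -- A Bézout combination of the two cubics eliminates u and leaves this constant.
  have hN : (3 * 7 ^ 4 * 11 ^ 3 : k) = 0 := by
    linear_combination (-2865898 - 4910602 * u + 7273253 * u ^ 2) * p1
      + (-960185 - 8677318 * u - 21733685 * u ^ 2) * p2
  have hcases : (3 : k) = 0 ∨ (7 : k) = 0 ∨ (11 : k) = 0 := by
    simpa [or_assoc] using hN
  rcases hcases with h | h | h
  · have hu1 : (u - 1) ^ 3 = 0 := by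
      linear_combination p2 + (-56 * u ^ 3 + 39 * u ^ 2 + 19 * u + 2) * h
    have hu1 : u = 1 := sub_eq_zero.mp (pow_eq_zero_iff (by norm_num) |>.mp hu1)
    rw [← hu, hu1] at e1
    left
    refine ⟨h, ?_⟩
    linear_combination e1 + 2 * w * h
  · exfalso
    have h2u : (2 * u - 1) ^ 2 = 0 := by
      linear_combination p2 - p1 + (48 * u ^ 3 + 44 * u ^ 2 + 13 * u + 1) * h
    have h2u : 2 * u - 1 = 0 := pow_eq_zero_iff (by norm_num) |>.mp h2u
    rw [hu] at h2u
    have hr : w ^ 2 * (r + w) = 0 := by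
      linear_combination h2 - h2u + (w ^ 2 * r - 3 * r ^ 2 * w - w ^ 3) * h
    obtain rfl : r = -w := by
      simpa [hw, add_eq_zero_iff_eq_neg] using hr
    have : w ^ 2 = 0 := by
      linear_combination h0 - w ^ 2 * h2u - (w ^ 5 - w ^ 2) * h
    exact hw (pow_eq_zero_iff (by norm_num) |>.mp this)
  · have hu1 : (u + 1) ^ 3 = 0 := by
      linear_combination -p1 + (46 * u ^ 3 + 17 * u ^ 2 + 4 * u) * h
    have hu1 : u = -1 := eq_neg_of_add_eq_zero_left (pow_eq_zero_iff (by norm_num) |>.mp hu1)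
    rw [← hu, hu1] at e1
    right
    have hr : r = 5 * w := by linear_combination -4 * e1 + (w - r) * h
    refine ⟨h, ?_⟩
    rw [hr]
    linear_combination -125 * hu + 125 * hu1 - 12 * h

theorem no_triple_root {k : Type*} [Field k] {r : ℤ} (hr : r ≡ 4 [ZMOD 165]) (w : k)
    (h0 : w ^ 5 - (r : k) * w ^ 4 + 7 * (r : k) ^ 2 * w ^ 3 - w ^ 2 - r * w - 7 * (r : k) ^ 2 = 0)
    (h1 : 5 * w ^ 4 - 4 * r * w ^ 3 + 21 * (r : k) ^ 2 * w ^ 2 - 2 * w - r = 0)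
    (h2 : 10 * w ^ 3 - 6 * r * w ^ 2 + 21 * (r : k) ^ 2 * w - 1 = 0) : False := by
  obtain ⟨m, hm⟩ := hr.symm.dvd
  have hm' : (r : k) = 165 * m + 4 := by
    have : r = 165 * m + 4 := by linarith
    rw [this]; push_cast; ring
  rcases no_triple_root_aux (r : k) w h0 h1 h2 with ⟨h, h'⟩ | ⟨h, h'⟩
  · have : (1 : k) = 0 := by linear_combination h' - hm' - (55 * m + 1) * h
    exact one_ne_zero this
  · rw [hm'] at h'
    have : (1 : k) = 0 := by
      linear_combination -5 * (h' - (15 * m * ((165 * m + 4) ^ 2 + 4 * (165 * m + 4) + 16)) * h) + 26 * h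
    exact one_ne_zero this

/-- The polynomial `w ^ 5 - r w ^ 4 + 7 r² w ^ 3 - w ^ 2 - r w - 7 r²`. -/
noncomputable def quintic {R : Type*} [CommRing R] (r : R) : Polynomial R :=
  .X ^ 5 - .C r * .X ^ 4 + .C (7 * r ^ 2) * .X ^ 3 - .X ^ 2 - .C r * .X - .C (7 * r ^ 2)


theorem quintic_map {R S : Type*} [CommRing R] [CommRing S] (f : R →+* S) (r : R) :
    (quintic r).map f = quintic (f r) := by
  simp [quintic, map_ofNat]

theorem quintic_eval {R : Type*} [CommRing R] (r w : R) :
    (quintic r).eval w = w ^ 5 - r * w ^ 4 + 7 * r ^ 2 * w ^ 3 - w ^ 2 - r * w - 7 * r ^ 2 := by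
  simp [quintic]

theorem quintic_natDegree {R : Type*} [CommRing R] [Nontrivial R] (r : R) :
    (quintic r).natDegree = 5 := by
  unfold quintic
  compute_degree!

theorem quintic_monic {R : Type*} [CommRing R] (r : R) : (quintic r).Monic := by
  nontriviality R
  unfold quintic
  monicity!

/-- Taylor expansion at w: the three lowest coefficients are the expressions in `no_triple_root`. -/
theorem quintic_comp {R : Type*} [CommRing R] (r w : R) :
    (quintic r).comp (X + C w) = X ^ 3 * (X ^ 2 + C (5 * w - r) * X
      + C (10 * w ^ 2 - 4 * r * w + 7 * r ^ 2)) + C (10 * w ^ 3 - 6 * r * w ^ 2 + 21 * r ^ 2 * w - 1) * X ^ 2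
      + C (5 * w ^ 4 - 4 * r * w ^ 3 + 21 * r ^ 2 * w ^ 2 - 2 * w - r) * X
      + C (w ^ 5 - r * w ^ 4 + 7 * r ^ 2 * w ^ 3 - w ^ 2 - r * w - 7 * r ^ 2) := by
  simp only [quintic, sub_comp, add_comp, mul_comp, pow_comp, X_comp, C_comp]
  simp only [map_sub, map_add, map_mul, map_pow, map_ofNat, map_one]
  ring

theorem coeff_cubic_remainder {R : Type*} [CommRing R] (q : R[X]) (a b c : R) :
    (X ^ 3 * q + C a * X ^ 2 + C b * X + C c).coeff 0 = c ∧
    (X ^ 3 * q + C a * X ^ 2 + C b * X + C c).coeff 1 = b ∧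
    (X ^ 3 * q + C a * X ^ 2 + C b * X + C c).coeff 2 = a := by
  simp [coeff_X_pow_mul', coeff_X, coeff_C, coeff_X_pow]

theorem quintic_coeff_of_pow_dvd {k : Type*} [Field k] (r w : k) (n : ℕ)
    (h : (X - C w) ^ n ∣ quintic r) :
    (0 < n → w ^ 5 - r * w ^ 4 + 7 * r ^ 2 * w ^ 3 - w ^ 2 - r * w - 7 * r ^ 2 = 0) ∧
    (1 < n → 5 * w ^ 4 - 4 * r * w ^ 3 + 21 * r ^ 2 * w ^ 2 - 2 * w - r = 0) ∧
    (2 < n → 10 * w ^ 3 - 6 * r * w ^ 2 + 21 * r ^ 2 * w - 1 = 0) := by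
  rw [X_sub_C_pow_dvd_iff, X_pow_dvd_iff, quintic_comp] at h
  obtain ⟨h0, h1, h2⟩ := coeff_cubic_remainder (X ^ 2 + C (5 * w - r) * X
    + C (10 * w ^ 2 - 4 * r * w + 7 * r ^ 2)) (10 * w ^ 3 - 6 * r * w ^ 2 + 21 * r ^ 2 * w - 1)
    (5 * w ^ 4 - 4 * r * w ^ 3 + 21 * r ^ 2 * w ^ 2 - 2 * w - r)
    (w ^ 5 - r * w ^ 4 + 7 * r ^ 2 * w ^ 3 - w ^ 2 - r * w - 7 * r ^ 2)
  exact ⟨fun hn => h0 ▸ h 0 hn, fun hn => h1 ▸ h 1 hn, fun hn => h2 ▸ h 2 hn⟩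

theorem not_cube_dvd_quintic {k : Type*} [Field k] {r : ℤ} (hr : r ≡ 4 [ZMOD 165]) (w : k) :
    ¬ (X - C w) ^ 3 ∣ quintic (r : k) := fun h ↦ by
  obtain ⟨h0, h1, h2⟩ := quintic_coeff_of_pow_dvd _ w 3 h
  exact no_triple_root hr w (h0 (by simp)) (h1 (by simp)) (h2 (by simp))

theorem prod_pow_card_dvd {k ι : Type*} [Field k] [Fintype ι] [DecidableEq k] (a : ι → k) (w : k) :
    (X - C w) ^ (Finset.univ.filter fun i => a i = w).card ∣ ∏ i, (X - C (a i)) := by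
  calc _ = ∏ i ∈ Finset.univ.filter fun i => a i = w, (X - C (a i)) := by
        rw [← Finset.prod_const]
        refine Finset.prod_congr rfl fun i hi => ?_
        rw [(Finset.mem_filter.mp hi).2]
    _ ∣ _ := Finset.prod_dvd_prod_of_subset _ _ _ (Finset.filter_subset _ _)

theorem card_fiber_le_two {k : Type*} [Field k] [DecidableEq k] {r : ℤ} (hr : r ≡ 4 [ZMOD 165]) (a : Fin 5 → k)
    (ha : quintic (r : k) = ∏ i, (X - C (a i))) (w : k) :
    (Finset.univ.filter fun i => a i = w).card ≤ 2 := by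
  by_contra! h
  exact not_cube_dvd_quintic hr w (ha ▸ (pow_dvd_pow _ h).trans (prod_pow_card_dvd a w))

/-! ### Square discriminant and evenness of the Galois action. -/

theorem esymm_of_quintic_eq_prod {R : Type*} [CommRing R] {r : R} {a : Fin 5 → R}
    (ha : quintic r = ∏ i, (X - C (a i))) :
    a 0 + a 1 + a 2 + a 3 + a 4 = r ∧
    a 0 * a 1 + a 0 * a 2 + a 0 * a 3 + a 0 * a 4 + a 1 * a 2 + a 1 * a 3 + a 1 * a 4 + a 2 * a 3
      + a 2 * a 4 + a 3 * a 4 = 7 * r ^ 2 ∧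
    a 0 * a 1 * a 2 + a 0 * a 1 * a 3 + a 0 * a 1 * a 4 + a 0 * a 2 * a 3 + a 0 * a 2 * a 4
      + a 0 * a 3 * a 4 + a 1 * a 2 * a 3 + a 1 * a 2 * a 4 + a 1 * a 3 * a 4 + a 2 * a 3 * a 4 = 1 ∧
    a 0 * a 1 * a 2 * a 3 + a 0 * a 1 * a 2 * a 4 + a 0 * a 1 * a 3 * a 4 + a 0 * a 2 * a 3 * a 4
      + a 1 * a 2 * a 3 * a 4 = -r := by
  rw [Fin.prod_univ_five] at ha
  have expand (b c d e f : R) : (X - C b) * (X - C c) * (X - C d) * (X - C e) * (X - C f) =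
      X ^ 5 - C (b + c + d + e + f) * X ^ 4 + C (b * c + b * d + b * e + b * f + c * d + c * e
      + c * f + d * e + d * f + e * f) * X ^ 3 - C (b * c * d + b * c * e + b * c * f + b * d * e
      + b * d * f + b * e * f + c * d * e + c * d * f + c * e * f + d * e * f) * X ^ 2
      + C (b * c * d * e + b * c * d * f + b * c * e * f + b * d * e * f + c * d * e * f) * X
      - C (b * c * d * e * f) := by
    simp only [map_add, map_mul]
    ring
  have coeffs (s t u v w : R) (n : ℕ) :
      (X ^ 5 - C s * X ^ 4 + C t * X ^ 3 - C u * X ^ 2 + C v * X - C w).coeff n =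
      if n = 0 then -w else if n = 1 then v else if n = 2 then -u else if n = 3 then t else
      if n = 4 then -s else if n = 5 then 1 else 0 := by
    rcases n with _ | _ | _ | _ | _ | _ | n <;> simp [coeff_X, coeff_C, coeff_X_pow]
  have hq : quintic r = X ^ 5 - C r * X ^ 4 + C (7 * r ^ 2) * X ^ 3 - C 1 * X ^ 2 + C (-r) * X
      - C (7 * r ^ 2) := by
    simp only [quintic, map_one, map_neg]
    ring
  rw [expand, hq] at ha
  have key (n : ℕ) := congrArg (coeff · n) ha
  simp only [coeffs] at key
  refine ⟨?_, ?_, ?_, ?_⟩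
  · have h := key 4
    norm_num at h
    linear_combination h
  · simpa using (key 3).symm
  · have h := key 2
    norm_num at h
    linear_combination h
  · simpa using (key 1).symm

theorem vandermonde_transpose_mul_self {R : Type*} [CommRing R] {n : ℕ} (a : Fin n → R) :
    (Matrix.vandermonde a).transpose * Matrix.vandermonde a =
      Matrix.of fun i j : Fin n => ∑ k, a k ^ (i + j : ℕ) := by
  ext i j
  simp [Matrix.mul_apply, Matrix.vandermonde_apply, pow_add]

/-- With V the Vandermonde matrix, VᵀV is the Hankel matrix of the power sums. These come from
Newton's identities up to degree 4 and from the recursion given by the quintic afterwards. -/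
theorem det_vandermonde_sq_of_quintic {R : Type*} [CommRing R] {r : R} {a : Fin 5 → R}
    (ha : quintic r = ∏ i, (X - C (a i))) :
    (Matrix.vandermonde a).det ^ 2 = (r * (9261 * r ^ 6 + 2038 * r ^ 3 - 27)) ^ 2 := by
  obtain ⟨e1, e2, e3, e4⟩ := esymm_of_quintic_eq_prod ha
  have hroot (i) : a i ^ 5 = r * a i ^ 4 - 7 * r ^ 2 * a i ^ 3 + a i ^ 2 + r * a i + 7 * r ^ 2 := by
    have : (quintic r).eval (a i) = 0 := by
      rw [ha, eval_prod]
      exact Finset.prod_eq_zero (Finset.mem_univ i) (by simp)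
    rw [quintic_eval] at this
    linear_combination this
  obtain ⟨P, hP⟩ : ∃ P : ℕ → R, ∀ n, P n = ∑ k, a k ^ n := ⟨_, fun _ => rfl⟩
  have P0 : P 0 = 5 := by simp [hP]
  have P1 : P 1 = r := by simp [hP, Fin.sum_univ_five, e1]
  have P2 : P 2 = -13 * r ^ 2 := by
    rw [hP, Fin.sum_univ_five]
    linear_combination (a 0 + a 1 + a 2 + a 3 + a 4 + r) * e1 - 2 * e2
  have P3 : P 3 = 3 - 20 * r ^ 3 := by
    have h : P 3 = (a 0 + a 1 + a 2 + a 3 + a 4) * P 2 - (a 0 * a 1 + a 0 * a 2 + a 0 * a 3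
        + a 0 * a 4 + a 1 * a 2 + a 1 * a 3 + a 1 * a 4 + a 2 * a 3 + a 2 * a 4 + a 3 * a 4) * P 1
        + 3 * (a 0 * a 1 * a 2 + a 0 * a 1 * a 3 + a 0 * a 1 * a 4 + a 0 * a 2 * a 3
        + a 0 * a 2 * a 4 + a 0 * a 3 * a 4 + a 1 * a 2 * a 3 + a 1 * a 2 * a 4 + a 1 * a 3 * a 4
        + a 2 * a 3 * a 4) := by
      simp only [hP, Fin.sum_univ_five]
      ring
    rw [h, e1, e2, e3, P1, P2]
    ring
  have P4 : P 4 = 8 * r + 71 * r ^ 4 := by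
    have h : P 4 = (a 0 + a 1 + a 2 + a 3 + a 4) * P 3 - (a 0 * a 1 + a 0 * a 2 + a 0 * a 3
        + a 0 * a 4 + a 1 * a 2 + a 1 * a 3 + a 1 * a 4 + a 2 * a 3 + a 2 * a 4 + a 3 * a 4) * P 2
        + (a 0 * a 1 * a 2 + a 0 * a 1 * a 3 + a 0 * a 1 * a 4 + a 0 * a 2 * a 3
        + a 0 * a 2 * a 4 + a 0 * a 3 * a 4 + a 1 * a 2 * a 3 + a 1 * a 2 * a 4 + a 1 * a 3 * a 4
        + a 2 * a 3 * a 4) * P 1 - 4 * (a 0 * a 1 * a 2 * a 3 + a 0 * a 1 * a 2 * a 4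
        + a 0 * a 1 * a 3 * a 4 + a 0 * a 2 * a 3 * a 4 + a 1 * a 2 * a 3 * a 4) := by
      simp only [hP, Fin.sum_univ_five]
      ring
    rw [h, e1, e2, e3, e4, P1, P2, P3]
    ring
  have hrec (n : ℕ) : P (n + 5) = r * P (n + 4) - 7 * r ^ 2 * P (n + 3) + P (n + 2)
      + r * P (n + 1) + 7 * r ^ 2 * P n := by
    simp only [hP, Finset.mul_sum, ← Finset.sum_add_distrib, ← Finset.sum_sub_distrib]
    refine Finset.sum_congr rfl fun i _ => ?_
    linear_combination a i ^ n * hroot i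
  have P5 := hrec 0
  have P6 := hrec 1
  have P7 := hrec 2
  have P8 := hrec 3
  norm_num only at P5 P6 P7 P8
  rw [P0, P1, P2, P3, P4] at P5
  rw [P1, P2, P3, P4, P5] at P6
  rw [P2, P3, P4, P5, P6] at P7
  rw [P3, P4, P5, P6, P7] at P8
  ring_nf at P5 P6 P7 P8
  have hM : (Matrix.vandermonde a).transpose * Matrix.vandermonde a =
      !![P 0, P 1, P 2, P 3, P 4; P 1, P 2, P 3, P 4, P 5; P 2, P 3, P 4, P 5, P 6;
        P 3, P 4, P 5, P 6, P 7; P 4, P 5, P 6, P 7, P 8] := by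
    rw [vandermonde_transpose_mul_self]
    ext i j
    simp only [Matrix.of_apply, ← hP]
    fin_cases i <;> fin_cases j <;> rfl
  rw [sq, ← congrArg (· * _) (Matrix.det_transpose (Matrix.vandermonde a)), ← Matrix.det_mul, hM,
    P0, P1, P2, P3, P4, P5, P6, P7, P8]
  simp [Matrix.det_succ_row_zero, Fin.sum_univ_succ, Fin.succAbove]
  ring

theorem branch_ne_zero {r : ℤ} (hr : r ≡ 4 [ZMOD 165]) :
    r * (9261 * r ^ 6 + 2038 * r ^ 3 - 27) ≠ 0 := by
  obtain ⟨m, hm⟩ := hr.symm.dvd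
  have hm : r = 165 * m + 4 := by linarith
  intro h
  rcases mul_eq_zero.mp h with h | h
  · omega
  -- Modulo 3 the second factor is r³, which is 1.
  · have : (3 : ℤ) ∣ 1 := by
      refine ⟨-(3087 * r ^ 6 + 679 * r ^ 3 - 9 + 55 * m * (r ^ 2 + 4 * r + 16) + 21), ?_⟩
      have h3 : r ^ 3 = 165 * m * (r ^ 2 + 4 * r + 16) + 64 := by rw [hm]; ring
      linear_combination h - h3
    omega

theorem det_vandermonde_ne_zero {R : Type*} [CommRing R] [IsDomain R] [CharZero R] {r : ℤ}
    (hr : r ≡ 4 [ZMOD 165]) {a : Fin 5 → R} (ha : quintic (r : R) = ∏ i, (X - C (a i))) :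
    (Matrix.vandermonde a).det ≠ 0 := by
  intro h
  have := det_vandermonde_sq_of_quintic ha
  rw [h] at this
  have h2 : (r : R) * (9261 * r ^ 6 + 2038 * r ^ 3 - 27) = 0 := by
    simpa using this.symm
  exact branch_ne_zero hr (by exact_mod_cast h2)

theorem roots_injective {R : Type*} [CommRing R] [IsDomain R] [CharZero R] {r : ℤ}
    (hr : r ≡ 4 [ZMOD 165]) {a : Fin 5 → R} (ha : quintic (r : R) = ∏ i, (X - C (a i))) :
    Function.Injective a :=
  Matrix.det_vandermonde_ne_zero_iff.mp (det_vandermonde_ne_zero hr ha)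

/-- The permutation representation of a group on the roots of a polynomial it fixes. -/
theorem exists_perm_representation {R G ι : Type*} [CommRing R] [IsDomain R] [Group G]
    [MulSemiringAction G R] [Fintype ι] {a : ι → R} (hinj : Function.Injective a)
    (h : ∀ (σ : G) (i : ι), ∃ j, a j = σ • a i) :
    ∃ ρ : G →* Equiv.Perm ι, ∀ σ i, a (ρ σ i) = σ • a i := by
  choose f hf using h
  have h1 (i) : f 1 i = i := hinj (by rw [hf, one_smul])
  have hmul (σ τ i) : f (σ * τ) i = f σ (f τ i) := hinj (by rw [hf, hf, hf, mul_smul])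
  refine ⟨{ toFun σ := ⟨f σ, f σ⁻¹, fun i => ?_, fun i => ?_⟩, map_one' := ?_, map_mul' := ?_ }, hf⟩
  · rw [← hmul, inv_mul_cancel, h1]
  · rw [← hmul, mul_inv_cancel, h1]
  · ext i; simp [h1]
  · intro σ τ; ext i; simp [hmul]

theorem exists_root_eq_smul {R G : Type*} [CommRing R] [IsDomain R] [Group G]
    [MulSemiringAction G R] {r : ℤ} {a : Fin 5 → R}
    (ha : quintic (r : R) = ∏ i, (X - C (a i))) (σ : G) (i : Fin 5) : ∃ j, a j = σ • a i := by
  have hi : (quintic (r : R)).eval (a i) = 0 := by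
    rw [ha, eval_prod]
    exact Finset.prod_eq_zero (Finset.mem_univ i) (by simp)
  have hσ : (quintic (r : R)).eval (σ • a i) = 0 := by
    have := congrArg (MulSemiringAction.toRingHom G R σ) hi
    rw [quintic_eval] at this ⊢
    simpa only [map_sub, map_add, map_mul, map_pow, map_intCast, map_ofNat, map_zero,
      MulSemiringAction.toRingHom_apply] using this
  rw [ha, eval_prod, Finset.prod_eq_zero_iff] at hσ
  obtain ⟨j, -, hj⟩ := hσ
  exact ⟨j, by simpa [sub_eq_zero, eq_comm] using hj⟩

/-- The Vandermonde determinant is plus or minus an integer, hence fixed by σ, while permuting its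
rows multiplies it by the sign; it is nonzero in characteristic 0. -/
theorem sign_eq_one {R G : Type*} [CommRing R] [IsDomain R] [CharZero R] [Group G]
    [MulSemiringAction G R] {r : ℤ} (hr : r ≡ 4 [ZMOD 165]) {a : Fin 5 → R}
    (ha : quintic (r : R) = ∏ i, (X - C (a i))) (σ : G) (π : Equiv.Perm (Fin 5))
    (hπ : ∀ i, a (π i) = σ • a i) : Equiv.Perm.sign π = 1 := by
  have hne := det_vandermonde_ne_zero hr ha
  have h1 : σ • (Matrix.vandermonde a).det = (Matrix.vandermonde a).det := by
    rcases sq_eq_sq_iff_eq_or_eq_neg.mp (det_vandermonde_sq_of_quintic ha) with h | h <;> rw [h]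
    · have := map_intCast (MulSemiringAction.toRingHom G R σ)
        (r * (9261 * r ^ 6 + 2038 * r ^ 3 - 27))
      simpa using this
    · have := map_intCast (MulSemiringAction.toRingHom G R σ)
        (-(r * (9261 * r ^ 6 + 2038 * r ^ 3 - 27)))
      simpa using this
  have h2 : σ • (Matrix.vandermonde a).det = Equiv.Perm.sign π * (Matrix.vandermonde a).det := by
    rw [← Matrix.det_permute]
    have := RingHom.map_det (MulSemiringAction.toRingHom G R σ) (Matrix.vandermonde a)
    refine this.trans (congrArg _ ?_)
    ext i j
    simp [Matrix.vandermonde_apply, hπ, smul_pow']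
  rw [h1] at h2
  rcases Int.units_eq_one_or (Equiv.Perm.sign π) with h | h
  · exact h
  · rw [h] at h2
    simp [self_eq_neg, hne] at h2

/-! ### Even permutations with small fibres, and recognition of A₅. -/

theorem card_support_eq_four : ∀ π : Equiv.Perm (Fin 5), Equiv.Perm.sign π = 1 → π * π = 1 →
    π ≠ 1 → (Finset.univ.filter fun i => π i ≠ i).card = 4 := by
  decide +kernel

/-- An even permutation preserving the fibres of a map whose fibres have at most two elements
is an involution. -/
theorem mul_self_of_fiber_le_two {k : Type*} [DecidableEq k] {c : Fin 5 → k}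
    (hc : ∀ w, (Finset.univ.filter fun i => c i = w).card ≤ 2) {π : Equiv.Perm (Fin 5)}
    (hπ : ∀ i, c (π i) = c i) : π * π = 1 := by
  ext1 i
  by_contra h
  simp only [Equiv.Perm.mul_apply, Equiv.Perm.one_apply] at h
  have h1 : π i ≠ i := fun h1 => h (by rw [h1, h1])
  have h2 : π (π i) ≠ π i := fun h2 => h1 (π.injective h2)
  have : ({i, π i, π (π i)} : Finset (Fin 5)).card ≤ 2 := by
    refine (Finset.card_le_card ?_).trans (hc (c i))
    intro j hj
    simp only [Finset.mem_insert, Finset.mem_singleton] at hj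
    rcases hj with rfl | rfl | rfl <;> simp [hπ]
  rw [Finset.card_eq_three.mpr ⟨_, _, _, h1.symm, Ne.symm h, h2.symm, rfl⟩] at this
  omega

/-- Both supports have 4 of the 5 points, so they share at least 3, and there π and τ agree because
fibres have at most 2 points. Thus πτ fixes those 3 points; if π ≠ τ it would also move 4, and 3 + 4
> 5. -/
theorem eq_of_fiber_le_two {k : Type*} [DecidableEq k] {c : Fin 5 → k}
    (hc : ∀ w, (Finset.univ.filter fun i => c i = w).card ≤ 2) {π τ : Equiv.Perm (Fin 5)}
    (hπ : ∀ i, c (π i) = c i) (hτ : ∀ i, c (τ i) = c i) (sπ : Equiv.Perm.sign π = 1)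
    (sτ : Equiv.Perm.sign τ = 1) (π1 : π ≠ 1) (τ1 : τ ≠ 1) : π = τ := by
  have hππ := mul_self_of_fiber_le_two hc hπ
  have hττ := mul_self_of_fiber_le_two hc hτ
  have cπ := card_support_eq_four π sπ hππ π1
  have cτ := card_support_eq_four τ sτ hττ τ1
  have hmul : ∀ i, c ((π * τ) i) = c i := fun i => by simp [hπ, hτ]
  by_contra hne
  have h1 : π * τ ≠ 1 := fun h => hne (by rw [← mul_one π, ← hττ, ← mul_assoc, h, one_mul])
  have c1 := card_support_eq_four (π * τ) (by simp [sπ, sτ]) (mul_self_of_fiber_le_two hc hmul) h1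
  have hcap : ∀ i, π i ≠ i → τ i ≠ i → (π * τ) i = i := by
    intro i hi hi'
    have : π i = τ i := by
      by_contra hn
      have : ({i, π i, τ i} : Finset (Fin 5)).card ≤ 2 := by
        refine (Finset.card_le_card ?_).trans (hc (c i))
        intro j hj
        simp only [Finset.mem_insert, Finset.mem_singleton] at hj
        rcases hj with rfl | rfl | rfl <;> simp [hπ, hτ]
      rw [Finset.card_eq_three.mpr ⟨_, _, _, hi.symm, hi'.symm, hn, rfl⟩] at this
      omega
    rw [Equiv.Perm.mul_apply, ← this, ← Equiv.Perm.mul_apply, hππ, Equiv.Perm.one_apply]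
  have hdisj : Disjoint (Finset.univ.filter fun i => (π * τ) i ≠ i)
      ((Finset.univ.filter fun i => π i ≠ i) ∩ (Finset.univ.filter fun i => τ i ≠ i)) := by
    rw [Finset.disjoint_left]
    intro i hi hi'
    simp only [Finset.mem_inter, Finset.mem_filter, Finset.mem_univ, true_and] at hi hi'
    exact hi (hcap i hi'.1 hi'.2)
  have h5 := Finset.card_le_univ ((Finset.univ.filter fun i => (π * τ) i ≠ i) ∪
      ((Finset.univ.filter fun i => π i ≠ i) ∩ (Finset.univ.filter fun i => τ i ≠ i)))
  have h6 := Finset.card_le_univ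
    ((Finset.univ.filter fun i => π i ≠ i) ∪ (Finset.univ.filter fun i => τ i ≠ i))
  have h7 := Finset.card_union_add_card_inter
    (Finset.univ.filter fun i => π i ≠ i) (Finset.univ.filter fun i => τ i ≠ i)
  rw [Finset.card_union_of_disjoint hdisj] at h5
  simp only [Fintype.card_fin] at h5 h6
  omega

/-- A subgroup of `A₅` whose order is divisible by `15` is everything. -/
theorem subgroup_alternatingGroup_five_eq_top (H : Subgroup (alternatingGroup (Fin 5)))
    (hH : 15 ∣ Nat.card H) : H = ⊤ := by
  have hcard : Nat.card (alternatingGroup (Fin 5)) = 60 := by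
    rw [nat_card_alternatingGroup]; simp [Nat.factorial]
  have hmul := H.card_mul_index
  rw [hcard] at hmul
  have hidx : H.index ≤ 4 := by
    obtain ⟨m, hm⟩ := hH
    rw [hm] at hmul
    have : 0 < m := Nat.pos_of_ne_zero (by rintro rfl; omega)
    nlinarith
  have := alternatingGroup.isSimpleGroup (α := Fin 5) (by simp)
  -- The normal core is the kernel of the action on at most 4 cosets. It cannot be trivial, since 60
  -- > 4!, so by simplicity it is everything.
  rcases Subgroup.Normal.eq_bot_or_eq_top (H := H.normalCore) inferInstance with h | h
  · rw [Subgroup.normalCore_eq_ker, MonoidHom.ker_eq_bot_iff] at h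
    have : Finite (alternatingGroup (Fin 5) ⧸ H) := inferInstance
    have hle := Nat.card_le_card_of_injective _ h
    rw [hcard, Nat.card_perm, ← Subgroup.index] at hle
    have := Nat.factorial_le hidx
    simp [Nat.factorial] at this
    omega
  · exact top_le_iff.mp (h ▸ H.normalCore_le)

/-- A group acting faithfully by even permutations on five points, whose order is divisible by
`15`, is `A₅`. -/
theorem nonempty_mulEquiv_alternatingGroup {G : Type*} [Group G] (ρ : G →* Equiv.Perm (Fin 5))
    (hinj : Function.Injective ρ) (hsign : ∀ g, Equiv.Perm.sign (ρ g) = 1)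
    (hG : 15 ∣ Nat.card G) : Nonempty (G ≃* alternatingGroup (Fin 5)) := by
  let ρ' : G →* alternatingGroup (Fin 5) :=
    ρ.codRestrict _ fun g => Equiv.Perm.mem_alternatingGroup.mpr (hsign g)
  have hinj' : Function.Injective ρ' := fun x y h => hinj (congrArg Subtype.val h)
  have htop := subgroup_alternatingGroup_five_eq_top ρ'.range
    ((Nat.card_congr (MonoidHom.ofInjective hinj').toEquiv) ▸ hG)
  exact ⟨(MonoidHom.ofInjective hinj').trans ((MulEquiv.subgroupCongr htop).trans Subgroup.topEquiv)⟩

/-! ### Reduction of the roots, and inertia. -/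

theorem quintic_eq_prod_map {R k : Type*} [CommRing R] [CommRing k] (f : R →+* k) {r : ℤ}
    {a : Fin 5 → R} (ha : quintic (r : R) = ∏ i, (X - C (a i))) :
    quintic (r : k) = ∏ i, (X - C (f (a i))) := by
  have := congrArg (Polynomial.map f) ha
  simpa [quintic_map, Polynomial.map_prod] using this

theorem card_fiber_map_le_two {R k : Type*} [CommRing R] [Field k] [DecidableEq k] (f : R →+* k)
    {r : ℤ} (hr : r ≡ 4 [ZMOD 165]) {a : Fin 5 → R} (ha : quintic (r : R) = ∏ i, (X - C (a i)))
    (w : k) : (Finset.univ.filter fun i => f (a i) = w).card ≤ 2 :=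
  card_fiber_le_two hr (fun i => f (a i)) (quintic_eq_prod_map f ha) w

theorem card_inertia_eq_two {R G : Type*} [CommRing R] [IsDomain R] [CharZero R] [Group G]
    [MulSemiringAction G R] {r : ℤ} (hr : r ≡ 4 [ZMOD 165]) {a : Fin 5 → R}
    (ha : quintic (r : R) = ∏ i, (X - C (a i))) {ρ : G →* Equiv.Perm (Fin 5)}
    (hρ : ∀ σ i, a (ρ σ i) = σ • a i) (hinj : Function.Injective ρ)
    (P : Ideal R) [P.IsPrime] (hP : P.inertia G ≠ ⊥) : Nat.card (P.inertia G) = 2 := by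
  classical
  let f : R →+* FractionRing (R ⧸ P) := (algebraMap _ _).comp (Ideal.Quotient.mk P)
  have hfib := card_fiber_map_le_two f hr ha
  have hpres (σ : P.inertia G) (i) : f (a (ρ σ i)) = f (a i) := by
    rw [hρ]
    exact congrArg (algebraMap (R ⧸ P) (FractionRing (R ⧸ P)))
      (Ideal.Quotient.eq.mpr (σ.2 (a i)))
  have hsign (σ : G) : Equiv.Perm.sign (ρ σ) = 1 := sign_eq_one hr ha σ _ (hρ σ)
  have hne (σ : P.inertia G) (h : σ ≠ 1) : ρ σ ≠ 1 := fun h' =>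
    h (Subtype.ext (hinj (by rw [h', OneMemClass.coe_one, map_one])))
  obtain ⟨σ, hσ⟩ := Subgroup.ne_bot_iff_exists_ne_one.mp hP
  rw [Nat.card_eq_two_iff' 1]
  refine ⟨σ, hσ, fun τ hτ => Subtype.ext (hinj ?_)⟩
  exact eq_of_fiber_le_two hfib (hpres τ) (hpres σ) (hsign τ) (hsign σ) (hne τ hτ) (hne σ hσ)

/-! ### Degree-one primes and roots modulo ℓ. -/

/-- The rational prime `ℓ` has a prime of degree one above it in the ring `R`. -/
def HasDegreeOnePrime (R : Type*) [CommRing R] (ℓ : ℕ) : Prop :=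
  ∃ P : Ideal R, P.IsPrime ∧ (ℓ : R) ∈ P ∧ ∀ x, x ^ ℓ - x ∈ P

/-- All five roots reduce into F_ℓ with fibres of size at most 2, so at least 5/2 distinct values
occur. -/
theorem three_le_card_roots_of_hasDegreeOnePrime {R : Type*} [CommRing R] {ℓ : ℕ} [Fact ℓ.Prime]
    (h : HasDegreeOnePrime R ℓ) {r : ℤ} (hr : r ≡ 4 [ZMOD 165]) {a : Fin 5 → R}
    (ha : quintic (r : R) = ∏ i, (X - C (a i))) :
    3 ≤ (Finset.univ.filter fun w : ZMod ℓ => (quintic (r : ZMod ℓ)).eval w = 0).card := by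
  classical
  obtain ⟨P, hP, hℓ, hx⟩ := h
  let k := FractionRing (R ⧸ P)
  let f : R →+* k := (algebraMap _ _).comp (Ideal.Quotient.mk P)
  have hf {x} (hxP : x ∈ P) : f x = 0 := by
    simp [f, Ideal.Quotient.eq_zero_iff_mem.mpr hxP]
  have hchar : CharP k ℓ := by
    have h0 : (ℓ : k) = 0 := by simpa using hf hℓ
    exact (CharP.charP_iff_prime_eq_zero Fact.out).mpr h0
  let ι : ZMod ℓ →+* k := ZMod.castHom dvd_rfl k
  have hw (i) : ∃ w : ZMod ℓ, ι w = f (a i) := by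
    have h1 : f (a i) ^ ℓ = f (a i) := by
      rw [← map_pow, ← sub_eq_zero, ← map_sub]
      exact hf (hx _)
    rw [← Subfield.mem_bot_iff_pow_eq_self k ℓ] at h1
    have : (⊥ : Subfield k) ≤ ι.fieldRange := bot_le
    exact this h1
  choose w hw using hw
  have hmaps : ∀ i ∈ (Finset.univ : Finset (Fin 5)),
      w i ∈ Finset.univ.filter fun w : ZMod ℓ => (quintic (r : ZMod ℓ)).eval w = 0 := by
    intro i _
    rw [Finset.mem_filter]
    refine ⟨Finset.mem_univ _, ι.injective ?_⟩
    have h2 : (quintic (r : k)).eval (f (a i)) = 0 := by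
      rw [quintic_eq_prod_map f ha, eval_prod]
      exact Finset.prod_eq_zero (Finset.mem_univ i) (by simp)
    rw [map_zero, ← h2, ← hw, ← eval_map_apply, quintic_map, map_intCast]
  have := Finset.card_le_mul_card_image_of_maps_to hmaps 2 fun b _ => by
    refine (Finset.card_le_card ?_).trans (card_fiber_map_le_two f hr ha (ι b))
    intro i hi
    simp only [Finset.mem_filter, Finset.mem_univ, true_and] at hi ⊢
    rw [← hw, hi]
  simp only [Finset.card_univ, Fintype.card_fin] at this
  omega

/-- Double counting of pairs (s, w): for fixed w the equation is a nonzero quadratic in s, so there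
are at most 2ℓ pairs, fewer than three per s. -/
theorem exists_card_roots_le_two (ℓ : ℕ) [Fact ℓ.Prime] (hℓ : 7 < ℓ) :
    ∃ s : ZMod ℓ, (Finset.univ.filter fun w : ZMod ℓ => (quintic s).eval w = 0).card ≤ 2 := by
  by_contra! h
  have hcast (n : ℕ) (hn : 0 < n) (hn' : n < ℓ) : (n : ZMod ℓ) ≠ 0 := fun h0 =>
    absurd (Nat.le_of_dvd hn ((ZMod.natCast_eq_zero_iff _ _).mp h0)) (by omega)
  have h2 : (2 : ZMod ℓ) ≠ 0 := by exact_mod_cast hcast 2 (by omega) (by omega)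
  have h7 : (7 : ZMod ℓ) ≠ 0 := by exact_mod_cast hcast 7 (by omega) (by omega)
  have hw (w : ZMod ℓ) :
      (Finset.univ.filter fun s : ZMod ℓ => (quintic s).eval w = 0).card ≤ 2 := by
    let p : (ZMod ℓ)[X] := C (7 * (w ^ 3 - 1)) * X ^ 2 + C (-(w ^ 4 + w)) * X + C (w ^ 5 - w ^ 2)
    -- If the leading coefficient vanishes then w³ = 1, and the linear coefficient is -2w ≠ 0.
    have hp0 : p ≠ 0 := by
      intro hp
      obtain ⟨-, c1, c2⟩ := coeff_cubic_remainder 0 (7 * (w ^ 3 - 1)) (-(w ^ 4 + w)) (w ^ 5 - w ^ 2)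
      rw [mul_zero, zero_add] at c1 c2
      change p.coeff 1 = _ at c1
      change p.coeff 2 = _ at c2
      rw [hp, coeff_zero] at c1 c2
      have h3 : w ^ 3 - 1 = 0 := by simpa [h7] using c2.symm
      have h4 : 2 * w = 0 := by linear_combination c1 - w * h3
      have h5 : w = 0 := by simpa [h2] using h4
      simp [h5] at h3
    have hdeg : p.natDegree ≤ 2 := natDegree_quadratic_le
    refine le_trans ?_ ((card_roots' p).trans hdeg)
    refine le_trans (Finset.card_le_card ?_) (Multiset.toFinset_card_le _)
    intro s hs
    rw [Finset.mem_filter, quintic_eval] at hs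
    rw [Multiset.mem_toFinset, mem_roots hp0, IsRoot.def]
    simp only [p, eval_add, eval_mul, eval_C, eval_pow, eval_X]
    linear_combination hs.2
  have hsum := Finset.sum_card_bipartiteAbove_eq_sum_card_bipartiteBelow
    (s := (Finset.univ : Finset (ZMod ℓ))) (t := (Finset.univ : Finset (ZMod ℓ)))
    (fun s w => (quintic s).eval w = 0)
  have hle := Finset.sum_le_card_nsmul (Finset.univ : Finset (ZMod ℓ)) _ 2 fun w _ => hw w
  have hge := Finset.card_nsmul_le_sum (Finset.univ : Finset (ZMod ℓ)) _ 3 fun s _ => h s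
  simp only [Finset.bipartiteAbove, Finset.bipartiteBelow] at hsum
  rw [hsum] at hge
  have := hge.trans hle
  simp only [Finset.card_univ, ZMod.card, smul_eq_mul] at this
  omega

theorem exists_ringHom_field.{u} {R : Type u} [CommRing R] (P : Ideal R) [P.IsPrime] :
    ∃ (k : Type u) (_ : Field k) (f : R →+* k), ∀ x ∈ P, f x = 0 :=
  ⟨FractionRing (R ⧸ P), inferInstance, (algebraMap _ _).comp (Ideal.Quotient.mk P), fun x hx => by
    simp [Ideal.Quotient.eq_zero_iff_mem.mpr hx]⟩

/-- A Frobenius element at P is shown to be trivial; then x ≡ x^ℓ mod P for all x. -/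
theorem hasDegreeOnePrime_of_dvd {R G : Type*} [CommRing R] [IsDomain R] [CharZero R]
    [Module.Finite ℤ R] [Group G] [Finite G]
    [MulSemiringAction G R] [SMulCommClass G ℤ R] [Algebra.IsInvariant ℤ R G]
    {r : ℤ} (hr : r ≡ 4 [ZMOD 165]) {a : Fin 5 → R}
    (ha : quintic (r : R) = ∏ i, (X - C (a i))) {ρ : G →* Equiv.Perm (Fin 5)}
    (hρ : ∀ σ i, a (ρ σ i) = σ • a i) (hinj : Function.Injective ρ)
    {ℓ : ℕ} (hℓ : ℓ.Prime) (hℓ3 : ℓ ≡ 1 [MOD 3]) (hdvd : (ℓ : ℤ) ∣ r) :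
    HasDegreeOnePrime R ℓ := by
  classical
  have hfact : Fact ℓ.Prime := ⟨hℓ⟩
  have hmax : (Ideal.span {(ℓ : ℤ)}).IsMaximal :=
    Int.ideal_span_isMaximal_of_prime ℓ
  obtain ⟨P, hPmax, hPℓ⟩ :=
    Ideal.exists_maximal_ideal_liesOver_of_isIntegral (S := R) (Ideal.span {(ℓ : ℤ)})
  have hunder : P.under ℤ = Ideal.span {(ℓ : ℤ)} := hPℓ.over.symm
  have hmem : (ℓ : R) ∈ P := by
    have : (ℓ : ℤ) ∈ P.under ℤ := hunder ▸ Ideal.mem_span_singleton_self _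
    simpa [Ideal.mem_comap] using this
  have hcard : Nat.card (ℤ ⧸ P.under ℤ) = ℓ := by
    rw [hunder, Nat.card_congr (Int.quotientSpanNatEquivZMod ℓ).toEquiv, Nat.card_zmod]
  have hfin : Finite (R ⧸ P) := by
    have : Finite (ℤ ⧸ Ideal.span {(ℓ : ℤ)}) :=
      Finite.of_equiv _ (Int.quotientSpanNatEquivZMod ℓ).symm.toEquiv
    exact Module.finite_of_finite (ℤ ⧸ Ideal.span {(ℓ : ℤ)})
  obtain ⟨φ, hφ⟩ := IsArithFrobAt.exists_of_isInvariant ℤ G P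
  have hφ (x : R) : φ • x - x ^ ℓ ∈ P := by
    have := hφ x
    rwa [hcard] at this
  obtain ⟨k, _, f, hf⟩ := exists_ringHom_field P
  have hℓ0 : (ℓ : k) = 0 := by simpa using hf _ hmem
  have hr0 : (r : k) = 0 := by
    obtain ⟨m, rfl⟩ := hdvd
    simp [hℓ0]
  obtain ⟨m, hm⟩ : ∃ m, ℓ = 3 * m + 1 := ⟨ℓ / 3, by
    have := hℓ3
    rw [Nat.ModEq] at this
    omega⟩
  have h3 : (3 : k) ≠ 0 := by
    intro h3
    rw [hm] at hℓ0
    push_cast at hℓ0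
    have : (1 : k) = 0 := by linear_combination hℓ0 - m * h3
    exact one_ne_zero this
  have hprod := quintic_eq_prod_map f ha
  have hroot (i) : f (a i) = 0 ∨ f (a i) ^ 3 = 1 := by
    have : (quintic (r : k)).eval (f (a i)) = 0 := by
      rw [hprod, eval_prod]
      exact Finset.prod_eq_zero (Finset.mem_univ i) (by simp)
    rw [quintic_eval, hr0] at this
    have h5 : f (a i) ^ 2 * (f (a i) ^ 3 - 1) = 0 := by linear_combination this
    simpa [sub_eq_zero] using h5
  -- The reduced roots are 0 or cube roots of unity, all fixed by x ↦ x^ℓ because ℓ ≡ 1 mod 3.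
  have hpres (i) : f (a (ρ φ i)) = f (a i) := by
    have h1 : f (φ • a i) = f (a i) ^ ℓ := by
      rw [← map_pow, ← sub_eq_zero, ← map_sub]
      exact hf _ (hφ _)
    rw [hρ, h1, hm, pow_succ, pow_mul]
    rcases hroot i with h | h
    · rw [h, mul_zero]
    · rw [h, one_pow, one_mul]
  have hφ1 : φ = 1 := by
    by_contra hne
    have hne : ρ φ ≠ 1 := fun h => hne (hinj (h.trans (map_one ρ).symm))
    have hfib := card_fiber_map_le_two f hr ha
    have h4 := card_support_eq_four (ρ φ) (sign_eq_one hr ha φ _ (hρ φ))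
      (mul_self_of_fiber_le_two (c := fun i => f (a i)) hfib hpres) hne
    -- A moved point shares its reduction with its image, giving a double root of w²(w³ - 1), which
    -- can only be 0. Four moved points would then lie in a fibre of size at most 2.
    have hsub : (Finset.univ.filter fun i => ρ φ i ≠ i) ⊆
        Finset.univ.filter fun i => f (a i) = 0 := by
      intro i hi
      simp only [Finset.mem_filter, Finset.mem_univ, true_and] at hi ⊢
      have hcard2 : 2 ≤ (Finset.univ.filter fun j => f (a j) = f (a i)).card := by
        rw [← Finset.card_pair hi]
        refine Finset.card_le_card fun j hj => ?_
        simp only [Finset.mem_insert, Finset.mem_singleton] at hj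
        rcases hj with rfl | rfl <;> simp [hpres]
      have hdvd2 : (X - C (f (a i))) ^ 2 ∣ quintic (r : k) := by
        rw [hprod]
        exact (pow_dvd_pow _ hcard2).trans (prod_pow_card_dvd (fun j => f (a j)) _)
      obtain ⟨-, h1, -⟩ := quintic_coeff_of_pow_dvd _ _ _ hdvd2
      have h1 := h1 (by norm_num)
      rw [hr0] at h1
      rcases hroot i with h | h
      · exact h
      · have : 3 * f (a i) = 0 := by linear_combination h1 - 5 * f (a i) * h
        simpa [h3] using this
    have := (Finset.card_le_card hsub).trans (hfib 0)
    omega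
  refine ⟨P, hPmax.isPrime, hmem, fun x => ?_⟩
  have := hφ x
  rw [hφ1, one_smul] at this
  simpa using P.neg_mem this

/-! ### Divisibility of the group order by 15. -/

/-- The quintic splits in R/P, so g has a root there and its degree divides the residue degree,
which divides the group order by the efg formula. -/
theorem natDegree_dvd_card_of_dvd_quintic {R G : Type*} [CommRing R] [IsDedekindDomain R]
    [CharZero R] [Module.Finite ℤ R] [Module.Free ℤ R] [Group G] [Finite G]
    [MulSemiringAction G R] [IsGaloisGroup G ℤ R] {r : ℤ} {a : Fin 5 → R}
    (ha : quintic (r : R) = ∏ i, (X - C (a i))) (p : ℕ) [Fact p.Prime] {g : (ZMod p)[X]}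
    (hg : Irreducible g) (hdvd : g ∣ quintic (r : ZMod p)) : g.natDegree ∣ Nat.card G := by
  have hp : p.Prime := Fact.out
  have hmax : (Ideal.span {(p : ℤ)}).IsMaximal := Int.ideal_span_isMaximal_of_prime p
  obtain ⟨P, hPmax, hP⟩ :=
    Ideal.exists_maximal_ideal_liesOver_of_isIntegral (S := R) (Ideal.span {(p : ℤ)})
  have hmem : (p : R) ∈ P := by
    have : (p : ℤ) ∈ P.under ℤ := hP.over ▸ Ideal.mem_span_singleton_self _
    simpa [Ideal.mem_comap] using this
  let _ : Field (R ⧸ P) := Ideal.Quotient.field P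
  have hchar : CharP (R ⧸ P) p :=
    (CharP.charP_iff_prime_eq_zero hp).mpr (by
      rw [← map_natCast (Ideal.Quotient.mk P)]
      exact Ideal.Quotient.eq_zero_iff_mem.mpr hmem)
  let _ : Algebra (ZMod p) (R ⧸ P) := ZMod.algebra _ p
  have hfin : Finite (R ⧸ P) := by
    have : Finite (ℤ ⧸ Ideal.span {(p : ℤ)}) :=
      Finite.of_equiv _ (Int.quotientSpanNatEquivZMod p).symm.toEquiv
    exact Module.finite_of_finite (ℤ ⧸ Ideal.span {(p : ℤ)})
  have hdeg : Module.finrank (ZMod p) (R ⧸ P) = P.inertiaDeg ℤ := by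
    have h1 : Nat.card (R ⧸ P) = p ^ Module.finrank (ZMod p) (R ⧸ P) := by
      rw [Module.natCard_eq_pow_finrank (K := ZMod p), Nat.card_zmod]
    have h2 := Ideal.absNorm_eq_pow_inertiaDeg' P hp
    rw [Ideal.inertiaDeg'_eq_inertiaDeg, Ideal.absNorm_apply, Submodule.cardQuot_apply] at h2
    exact Nat.pow_right_injective hp.two_le (h1.symm.trans h2)
  have hdvd1 : Module.finrank (ZMod p) (R ⧸ P) ∣ Nat.card G := by
    rw [hdeg, ← Ideal.inertiaDegIn_eq_inertiaDeg (Ideal.span {(p : ℤ)}) P G,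
      ← Ideal.ncard_primesOver_mul_ramificationIdxIn_mul_inertiaDegIn (Ideal.span {(p : ℤ)}) R G]
    exact Dvd.intro_left _ (mul_assoc _ _ _)
  have hsplit : (g.map (algebraMap (ZMod p) (R ⧸ P))).Splits := by
    refine Splits.of_dvd (g := (quintic (r : ZMod p)).map (algebraMap (ZMod p) (R ⧸ P))) ?_ ?_
      (Polynomial.map_dvd _ hdvd)
    · rw [quintic_map, map_intCast, quintic_eq_prod_map (Ideal.Quotient.mk P) ha]
      exact Splits.prod fun i _ => Splits.X_sub_C _
    · exact ((quintic_monic _).map _).ne_zero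
  obtain ⟨x, hx⟩ := hsplit.exists_eval_eq_zero (by
    rw [degree_map]
    exact (degree_pos_of_irreducible hg).ne')
  have hx' : aeval x g = 0 := by rwa [eval_map_algebraMap] at hx
  have hmin : (minpoly (ZMod p) x).natDegree = g.natDegree := by
    rw [← minpoly.eq_of_irreducible hg hx', natDegree_mul_C]
    simpa using hg.ne_zero
  rw [← hmin, ← IntermediateField.adjoin.finrank (.of_finite _ x)]
  refine dvd_trans ?_ hdvd1
  exact Dvd.intro _ (Module.finrank_mul_finrank (ZMod p) (IntermediateField.adjoin (ZMod p) {x}) (R ⧸ P))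

instance : Fact (Nat.Prime 5) := ⟨by norm_num⟩

theorem irreducible_cubic_zmod_five : Irreducible (X ^ 3 + X ^ 2 + X + C 3 : (ZMod 5)[X]) := by
  have hdeg : (X ^ 3 + X ^ 2 + X + C 3 : (ZMod 5)[X]).natDegree = 3 := by compute_degree!
  refine irreducible_of_degree_le_three_of_not_isRoot (by simp [hdeg]) fun x => ?_
  rw [IsRoot.def]
  simp only [eval_add, eval_pow, eval_X, eval_C]
  revert x
  decide

theorem cubic_dvd_quintic_zmod_five {r : ℤ} (hr : r ≡ 4 [ZMOD 165]) :
    (X ^ 3 + X ^ 2 + X + C 3 : (ZMod 5)[X]) ∣ quintic (r : ZMod 5) := by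
  have : (r : ZMod 5) = 4 := by
    have := (ZMod.intCast_eq_intCast_iff r 4 5).mpr (hr.of_mul_right 33)
    simpa using this
  rw [this]
  refine ⟨(X - C 2) * (X - C 3), ?_⟩
  have h5 : (5 : (ZMod 5)[X]) = 0 := by
    rw [← C_ofNat]; exact (congrArg C (by decide : (5 : ZMod 5) = 0)).trans C_0
  simp only [quintic, map_mul, map_pow, map_ofNat]
  linear_combination (22 * X ^ 3 - X ^ 2 + X - 26) * h5

theorem irreducible_quintic_zmod_three : Irreducible (quintic (1 : ZMod 3)) := by
  rw [(quintic_monic _).irreducible_iff_lt_natDegree_lt (by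
    intro h
    have := congrArg natDegree h
    rw [quintic_natDegree, natDegree_one] at this
    omega)]
  intro q hq hdeg
  rw [quintic_natDegree] at hdeg
  have hdeg : q.natDegree = 1 ∨ q.natDegree = 2 := by
    simp at hdeg; omega
  rcases hdeg with h | h
  · have : q = X + C (q.coeff 0) := hq.eq_X_add_C h
    rw [this, ← sub_neg_eq_add, ← C_neg, dvd_iff_isRoot, IsRoot.def, quintic_eval]
    generalize -q.coeff 0 = x
    revert x
    decide
  · obtain ⟨b, c, rfl⟩ : ∃ b c : ZMod 3, q = X ^ 2 + C b * X + C c := by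
      refine ⟨q.coeff 1, q.coeff 0, ?_⟩
      have h2 : q.coeff 2 = 1 := h ▸ hq
      conv_lhs => rw [q.as_sum_range' 3 (by omega)]
      simp only [Finset.sum_range_succ, Finset.sum_range_zero, ← C_mul_X_pow_eq_monomial, h2]
      simp
      ring
    -- Symbolic long division by a generic monic quadratic; the linear remainder is nonzero for all
    -- nine pairs (b, c).
    have hdiv : quintic (1 : ZMod 3) = (X ^ 2 + C b * X + C c) * (X ^ 3 + C (-1 - b) * X ^ 2
        + C (7 - b * (-1 - b) - c) * X + C (-1 - b * (7 - b * (-1 - b) - c) - c * (-1 - b)))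
        + (C (-1 - b * (-1 - b * (7 - b * (-1 - b) - c) - c * (-1 - b))
            - c * (7 - b * (-1 - b) - c)) * X
          + C (-7 - c * (-1 - b * (7 - b * (-1 - b) - c) - c * (-1 - b)))) := by
      simp only [quintic, map_mul, map_pow, map_sub, map_neg, map_ofNat, map_one]
      ring
    rw [hdiv, dvd_add_right (dvd_mul_right _ _)]
    intro hdvd
    have hzero := eq_zero_of_dvd_of_natDegree_lt hdvd
      (lt_of_le_of_lt natDegree_linear_le (by rw [h]; norm_num))
    have c0 := congrArg (coeff · 0) hzero
    have c1 := congrArg (coeff · 1) hzero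
    simp only [coeff_add, coeff_C_mul, coeff_X_zero, coeff_X_one, coeff_C_zero, mul_zero, zero_add,
      coeff_zero, mul_one, coeff_C_succ, add_zero] at c0 c1
    clear * - c0 c1
    revert b c
    decide

/-! ### Construction of infinitely many fields. -/

theorem Polynomial.Splits.exists_eq_prod_fin {K : Type*} [Field K] {p : K[X]} (hp : p.Splits)
    (hm : p.Monic) {n : ℕ} (hn : p.natDegree = n) :
    ∃ b : Fin n → K, p = ∏ i, (X - C (b i)) := by
  have hcard : p.roots.toList.length = n := by
    rw [Multiset.length_toList, ← hn, hp.natDegree_eq_card_roots]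
  subst hcard
  refine ⟨fun i => p.roots.toList[i], ?_⟩
  conv_lhs => rw [hp.eq_prod_roots_of_monic hm, ← Multiset.coe_toList p.roots]
  rw [Multiset.map_coe, Multiset.prod_coe]
  exact (Fin.prod_univ_fun_getElem p.roots.toList fun x => X - C x).symm

theorem exists_roots_and_representation (K : Type*) [Field K] [NumberField K] {r : ℤ}
    (hr : r ≡ 4 [ZMOD 165]) [IsSplittingField ℚ K (quintic (r : ℚ))] :
    ∃ (a : Fin 5 → 𝓞 K) (ρ : Gal(K/ℚ) →* Equiv.Perm (Fin 5)),
      quintic (r : 𝓞 K) = ∏ i, (X - C (a i)) ∧ (∀ σ i, a (ρ σ i) = σ • a i) ∧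
      Function.Injective ρ := by
  have hsplit := IsSplittingField.splits K (quintic (r : ℚ))
  rw [quintic_map, map_intCast] at hsplit
  obtain ⟨b, hb⟩ := hsplit.exists_eq_prod_fin (quintic_monic _) (quintic_natDegree _)
  have hint (i) : IsIntegral ℤ (b i) := by
    refine ⟨quintic r, quintic_monic r, ?_⟩
    rw [← eval_map, quintic_map, eq_intCast, hb, eval_prod]
    exact Finset.prod_eq_zero (Finset.mem_univ i) (by simp)
  let a (i : Fin 5) : 𝓞 K := ⟨b i, hint i⟩
  have hab (i) : algebraMap (𝓞 K) K (a i) = b i := rfl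
  have ha : quintic (r : 𝓞 K) = ∏ i, (X - C (a i)) := by
    apply Polynomial.map_injective (algebraMap (𝓞 K) K) NumberField.RingOfIntegers.coe_injective
    simp [quintic_map, Polynomial.map_prod, hab, hb]
  obtain ⟨ρ, hρ⟩ := exists_perm_representation (roots_injective hr ha)
    (exists_root_eq_smul (G := Gal(K/ℚ)) ha)
  refine ⟨a, ρ, ha, hρ, (injective_iff_map_eq_one ρ).mpr fun σ hσ => ?_⟩
  have hfix (i) : σ (b i) = b i := by
    have := hρ σ i
    rw [hσ] at this
    exact (congrArg (algebraMap (𝓞 K) K) this).symm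
  have htop := IsSplittingField.adjoin_rootSet K (quintic (r : ℚ))
  have heq : (σ : K →ₐ[ℚ] K) = AlgHom.id ℚ K := by
    refine AlgHom.ext_of_adjoin_eq_top htop fun x hx => ?_
    have hx := (mem_rootSet.mp hx).2
    rw [aeval_def, ← eval_map, quintic_map, map_intCast, hb, eval_prod,
      Finset.prod_eq_zero_iff] at hx
    obtain ⟨i, -, hi⟩ := hx
    rw [eval_sub, eval_X, eval_C, sub_eq_zero] at hi
    rw [hi]
    exact hfix i
  ext x
  exact congrArg (fun τ : K →ₐ[ℚ] K => τ x) heq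

theorem fifteen_dvd_card {R G : Type*} [CommRing R] [IsDedekindDomain R]
    [CharZero R] [Module.Finite ℤ R] [Module.Free ℤ R] [Group G] [Finite G]
    [MulSemiringAction G R] [IsGaloisGroup G ℤ R] {r : ℤ} (hr : r ≡ 4 [ZMOD 165])
    {a : Fin 5 → R} (ha : quintic (r : R) = ∏ i, (X - C (a i))) : 15 ∣ Nat.card G := by
  have h1 : (r : ZMod 3) = 1 :=
    ((ZMod.intCast_eq_intCast_iff r 4 3).mpr (hr.of_mul_right 55)).trans (by decide)
  have h5 := natDegree_dvd_card_of_dvd_quintic (G := G) ha 3 irreducible_quintic_zmod_three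
    (by rw [h1])
  have h3 := natDegree_dvd_card_of_dvd_quintic (G := G) ha 5 irreducible_cubic_zmod_five
    (cubic_dvd_quintic_zmod_five hr)
  rw [quintic_natDegree] at h5
  rw [show (X ^ 3 + X ^ 2 + X + C 3 : (ZMod 5)[X]).natDegree = 3 by compute_degree!] at h3
  exact Nat.Coprime.mul_dvd_of_dvd_of_dvd (by norm_num) h3 h5

theorem exists_parameter {ℓ : ℕ} (hℓ : ℓ.Prime) (hℓ11 : 11 < ℓ) {T : Finset ℕ}
    (hT : ∀ q ∈ T, q.Prime ∧ 11 < q) (hℓT : ℓ ∉ T) :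
    ∃ r : ℤ, r ≡ 4 [ZMOD 165] ∧ (ℓ : ℤ) ∣ r ∧ ∀ q ∈ T, ∃ _ : Fact q.Prime,
      (Finset.univ.filter fun w : ZMod q => (quintic (r : ZMod q)).eval w = 0).card ≤ 2 := by
  have hs (q : ℕ) : ∃ s : ℕ, q ∈ T → ∃ _ : Fact q.Prime,
      (Finset.univ.filter fun w : ZMod q => (quintic (s : ZMod q)).eval w = 0).card ≤ 2 := by
    by_cases hq : q ∈ T
    · have : Fact q.Prime := ⟨(hT q hq).1⟩
      obtain ⟨s, hs⟩ := exists_card_roots_le_two q (by have := (hT q hq).2; omega)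
      refine ⟨s.val, fun _ => ⟨this, ?_⟩⟩
      rwa [ZMod.natCast_val, ZMod.cast_id', id]
    · exact ⟨0, fun h => absurd h hq⟩
  choose s hs using hs
  have hprime {q : ℕ} (hq : q.Prime) (hq11 : 11 < q) : Nat.Coprime 165 q := by
    rw [Nat.coprime_comm, hq.coprime_iff_not_dvd, show 165 = 3 * (5 * 11) from rfl, hq.dvd_mul,
      hq.dvd_mul]
    rintro (h | h | h) <;> have := Nat.le_of_dvd (by norm_num) h <;> omega
  -- The modulus 165 is composite, so the cases in the residue function below do not collide.
  have h165 : 165 ∉ insert ℓ T := by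
    intro h
    have : Nat.Prime 165 := by
      rcases Finset.mem_insert.mp h with h | h
      · exact h ▸ hℓ
      · exact (hT _ h).1
    norm_num at this
  have hmem {q : ℕ} (hq : q ∈ insert ℓ T) : q.Prime ∧ 11 < q := by
    rcases Finset.mem_insert.mp hq with rfl | h
    · exact ⟨hℓ, hℓ11⟩
    · exact hT _ h
  obtain ⟨k, hk⟩ := Nat.chineseRemainderOfFinset
    (fun q => if q = 165 then 4 else if q = ℓ then 0 else s q) id (insert 165 (insert ℓ T))
    (by
      intro q hq
      rcases Finset.mem_insert.mp hq with rfl | h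
      · norm_num
      · exact (hmem h).1.ne_zero)
    (by
      intro p hp q hq hpq
      simp only [Function.onFun, id]
      rcases Finset.mem_insert.mp hp with rfl | hp <;> rcases Finset.mem_insert.mp hq with rfl | hq
      · exact absurd rfl hpq
      · exact hprime (hmem hq).1 (hmem hq).2
      · exact (hprime (hmem hp).1 (hmem hp).2).symm
      · exact (Nat.coprime_primes (hmem hp).1 (hmem hq).1).mpr hpq)
  refine ⟨k, ?_, ?_, fun q hq => ?_⟩
  · have := hk 165 (Finset.mem_insert_self _ _)
    exact Int.natCast_modEq_iff.mpr (by simpa using this)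
  · have := hk ℓ (by simp)
    rw [if_neg (by rintro rfl; simp at h165), if_pos rfl] at this
    exact Int.natCast_dvd_natCast.mpr ((Nat.modEq_zero_iff_dvd).mp this)
  · obtain ⟨hq', h⟩ := hs q hq
    refine ⟨hq', ?_⟩
    have := hk q (by simp [hq])
    rw [if_neg (by rintro rfl; simp [hq] at h165), if_neg (by rintro rfl; exact hℓT hq)] at this
    rwa [Int.cast_natCast, (ZMod.natCast_eq_natCast_iff _ _ _).mpr this]

theorem exists_intermediateField {ℓ : ℕ} (hℓ : ℓ.Prime) (hℓ3 : ℓ ≡ 1 [MOD 3]) (hℓ11 : 11 < ℓ)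
    {T : Finset ℕ} (hT : ∀ q ∈ T, q.Prime ∧ 11 < q) (hℓT : ℓ ∉ T) :
    ∃ K : IntermediateField ℚ (AlgebraicClosure ℚ), (FiniteDimensional ℚ K ∧ IsGalois ℚ K ∧
      Nonempty (Gal(K/ℚ) ≃* alternatingGroup (Fin 5)) ∧
      ∀ P : Ideal (𝓞 K), P.IsPrime → P ≠ ⊥ →
        P.inertia Gal(K/ℚ) ≠ ⊥ → Nat.card (P.inertia Gal(K/ℚ)) = 2) ∧
      HasDegreeOnePrime (𝓞 K) ℓ ∧ ∀ q ∈ T, ¬ HasDegreeOnePrime (𝓞 K) q := by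
  obtain ⟨r, hr, hdvd, hroots⟩ := exists_parameter hℓ hℓ11 hT hℓT
  let K : IntermediateField ℚ (AlgebraicClosure ℚ) :=
    IntermediateField.adjoin ℚ ((quintic (r : ℚ)).rootSet (AlgebraicClosure ℚ))
  have hsplit : IsSplittingField ℚ K (quintic (r : ℚ)) :=
    IntermediateField.adjoin_rootSet_isSplittingField (IsAlgClosed.splits _)
  have hfin : FiniteDimensional ℚ K := IsSplittingField.finiteDimensional K (quintic (r : ℚ))
  have hnorm : Normal ℚ K := Normal.of_isSplittingField (quintic (r : ℚ))
  have hgal : IsGalois ℚ K := ⟨⟩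
  have hnf : NumberField K := ⟨⟩
  obtain ⟨a, ρ, ha, hρ, hinj⟩ := exists_roots_and_representation K hr
  refine ⟨K, ⟨hfin, hgal, ?_, fun P hP _ hI => ?_⟩, ?_, fun q hq hdeg => ?_⟩
  · exact nonempty_mulEquiv_alternatingGroup ρ hinj (fun σ => sign_eq_one hr ha σ _ (hρ σ))
      (fifteen_dvd_card hr ha)
  · exact card_inertia_eq_two hr ha hρ hinj P hI
  · exact hasDegreeOnePrime_of_dvd hr ha hρ hinj hℓ hℓ3 hdvd
  · obtain ⟨_, h⟩ := hroots q hq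
    have := three_le_card_roots_of_hasDegreeOnePrime hdeg hr ha
    omega

theorem theorem3p1 :
    Set.Infinite {K : IntermediateField ℚ (AlgebraicClosure ℚ) |
      FiniteDimensional ℚ K ∧ IsGalois ℚ K ∧
      Nonempty (Gal(K/ℚ) ≃* alternatingGroup (Fin 5)) ∧
      ∀ P : Ideal (𝓞 K), P.IsPrime → P ≠ ⊥ →
        P.inertia Gal(K/ℚ) ≠ ⊥ → Nat.card (P.inertia Gal(K/ℚ)) = 2} := by
  have hinf : {p : ℕ | p.Prime ∧ p ≡ 1 [MOD 3] ∧ 11 < p}.Infinite := by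
    rw [Set.infinite_iff_exists_gt]
    intro n
    obtain ⟨p, hp, hlt, hmod⟩ := Nat.exists_prime_gt_modEq_one (k := 3) (max n 11) (by norm_num)
    exact ⟨p, ⟨hp, hmod, by omega⟩, by omega⟩
  let e := hinf.natEmbedding
  -- The excluded set T holds the primes of all earlier indices, so `K n` has no degree-one prime
  -- over `e i` for i < n, whereas `K i` has one.
  have key (n : ℕ) := exists_intermediateField (ℓ := e n)
    (T := (Finset.range n).image fun i => (e i : ℕ)) (e n).2.1 (e n).2.2.1 (e n).2.2.2
    (by
      intro q hq
      obtain ⟨i, -, rfl⟩ := Finset.mem_image.mp hq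
      exact ⟨(e i).2.1, (e i).2.2.2⟩)
    (by
      intro h
      obtain ⟨i, hi, h⟩ := Finset.mem_image.mp h
      exact (Finset.mem_range.mp hi).ne (e.injective (Subtype.ext h)))
  choose K hK hsplit hnot using key
  refine Set.infinite_of_injective_forall_mem (f := K) ?_ hK
  have hne {i n : ℕ} (hin : i < n) : K i ≠ K n := fun h => hnot n (e i)
    (Finset.mem_image_of_mem _ (Finset.mem_range.mpr hin)) (h ▸ hsplit i)
  exact fun i n h => (lt_trichotomy i n).elim (fun hin => absurd h (hne hin))
    fun hni => hni.elim id fun hni => absurd h.symm (hne hni)
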